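/- Let $p,d\ge 0$ be integers, $\mathrm{St}(p,d)=\{V\in\mathbb R^{p\times d}: V^\top V=I_d\}$, $\|\cdot\|$ the Frobenius norm, $\alpha\ge 0$, and let $f$ be a contrastive inverse regression (CIR) loss, that is, one of the following functions of $V\in\mathbb R^{p\times d}$. (a) Population loss: $f(V)=\mathbb E_y\big[\mathrm{dist}^2(\mathbb E[x\mid y],\mathcal C(\Sigma_{xx}V))\big]-\alpha\,\mathbb E_{\tilde y}\big[\mathrm{dist}^2(\mathbb E[\tilde x\mid\tilde y],\mathcal C(\Sigma_{\tilde x\tilde x}V))\big]$, where $(x,y)$ and $(\tilde x,\tilde y)$ are random elements of $\mathbb R^p\times\mathbb R$, $x$ and $\tilde x$ are square integrable and centered with nonsingular covariance matrices $\Sigma_{xx}$, $\Sigma_{\tilde x\tilde x}$, $\mathcal C(M)$ is the column space of $M$, and $\mathrm{dist}$ is the Euclidean distance. (b) Matrix form: $f(V)=-\operatorname{tr}\big(V^\top AV(V^\top BV)^{-1}\big)+\alpha\operatorname{tr}\big(V^\top\tilde AV(V^\top\tilde BV)^{-1}\big)$ with $A=\Sigma_{xx}\Sigma_x\Sigma_{xx}$,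 $B=\Sigma_{xx}^2$, $\tilde A=\Sigma_{\tilde x\tilde x}\Sigma_{\tilde x}\Sigma_{\tilde x\tilde x}$, $\tilde B=\Sigma_{\tilde x\tilde x}^2$, for any symmetric positive definite $\Sigma_{xx},\Sigma_{\tilde x\tilde x}$ and symmetric positive semidefinite $\Sigma_x,\Sigma_{\tilde x}$ in $\mathbb R^{p\times p}$ (for instance the population matrices $\mathrm{Cov}(x)$, $\mathrm{Cov}(\mathbb E[x\mid y])$, or their sample estimates). Write $\nabla f(V)=(\partial f/\partial V_{ij})_{ij}$ and $D_V\mathcal L(V,\Lambda)=\nabla f(V)-V\Lambda$; for symmetric $\Lambda$ this is the gradient in $V$ of the Lagrangian $\mathcal L(V,\Lambda)=f(V)-\frac12\langle\Lambda,V^\top V-I_d\rangle$. Write $D_V\mathcal L(V)=D_V\mathcal L(V,\Lambda(V))$ with $\Lambda(V)=\nabla f(V)^\top V$. The scaled gradient projection method (SGPM) has parameters $\eta\in[0,1)$, $\rho_1,\delta\in(0,1)$ and $0<\tau_m\le\tau_M$. It starts from any $V_0\in\mathrm{St}(p,d)$ with $Q_0=1$, $C_0=f(V_0)$. At step $k$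 it takes any $\mu_k\in[0,1]$ and any trial step size $t_k\in[\tau_m,\tau_M]$, puts $A_k=\nabla f(V_k)V_k^\top-V_k\nabla f(V_k)^\top$ and $Y_k(\tau)=V_k-\tau(I_p+\mu_k\tau A_k)^{-1}\nabla f(V_k)$, and lets $\tau_k=t_k\delta^{j}$ with the least integer $j\ge0$ such that $$f(Y_k(\tau_k))\le C_k+\rho_1\tau_k\,Df(V_k)[\dot Y_k(0)].$$ Then $V_{k+1}=\pi(Y_k(\tau_k))$, where $\pi(X)\in\arg\min_{Q\in\mathrm{St}(p,d)}\|X-Q\|$, and $Q_{k+1}=\eta Q_k+1$, $C_{k+1}=(\eta Q_kC_k+f(V_{k+1}))/Q_{k+1}$. Let $\{V_k\}$ be an infinite sequence generated by SGPM (run without a stopping test). Then every accumulation point $V_*$ of $\{V_k\}$ satisfies the KKT conditions: there is a symmetric $\Lambda\in\mathbb R^{d\times d}$ with $\nabla f(V_*)-V_*\Lambda=0$, and $V_*^\top V_*=I_d$. Moreover $\lim_{k\to\infty}\|D_V\mathcal L(V_k)\|=0$. -/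

import Mathlib

open MeasureTheory ProbabilityTheory Filter Topology Matrix

-- Matrices carry the Frobenius norm.
attribute [local instance] Matrix.frobeniusNormedAddCommGroup Matrix.frobeniusNormedSpace

noncomputable section

namespace CIR

variable {p d : ℕ}

/-! ### The CIR loss -/

/-- The covariance matrix `Cov(x)` of the first component of a pair `(x, y)` in `ℝᵖ × ℝ` with
joint law `P`. -/
def covMat (P : Measure (EuclideanSpace ℝ (Fin p) × ℝ)) : Matrix (Fin p) (Fin p) ℝ :=
  Matrix.of fun i j => covariance (fun z => z.1 i) (fun z => z.1 j) P

/-- The inverse regression curve `v_y = E[x | y]`, as a random vector on `ℝᵖ × ℝ`. -/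
def inverseRegression (P : Measure (EuclideanSpace ℝ (Fin p) × ℝ)) :
    EuclideanSpace ℝ (Fin p) × ℝ → EuclideanSpace ℝ (Fin p) :=
  condExp (MeasurableSpace.comap Prod.snd inferInstance) P Prod.fst

/-- The column space `C(M)` of a matrix, as a subspace of the Euclidean space `ℝᵖ`. -/
def colSpace (M : Matrix (Fin p) (Fin d) ℝ) : Submodule ℝ (EuclideanSpace ℝ (Fin p)) :=
  LinearMap.range (Matrix.toEuclideanLin M)

/-- `E_y [d²(E[x | y], C(Σ_xx V))]` with `d` the Euclidean distance. -/
def sirLoss (P : Measure (EuclideanSpace ℝ (Fin p) × ℝ)) (V : Matrix (Fin p) (Fin d) ℝ) : ℝ :=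
  ∫ z, Metric.infDist (inverseRegression P z)
    (colSpace (covMat P * V) : Set (EuclideanSpace ℝ (Fin p))) ^ 2 ∂P

/-- `tr(Vᵀ A V (Vᵀ B V)⁻¹)`. -/
def traceRatio (A B : Matrix (Fin p) (Fin p) ℝ) (V : Matrix (Fin p) (Fin d) ℝ) : ℝ :=
  (Vᵀ * A * V * (Vᵀ * B * V)⁻¹).trace

/-- `-tr(Vᵀ A V (Vᵀ B V)⁻¹) + α tr(Vᵀ A' V (Vᵀ B' V)⁻¹)` with `A = Σ_xx Σ_x Σ_xx`, `B = Σ_xx²`,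
and `A'`, `B'` formed in the same way from the background matrices. -/
def traceLoss (Sxx Sx Sxx' Sx' : Matrix (Fin p) (Fin p) ℝ) (α : ℝ)
    (V : Matrix (Fin p) (Fin d) ℝ) : ℝ :=
  -traceRatio (Sxx * Sx * Sxx) (Sxx ^ 2) V + α * traceRatio (Sxx' * Sx' * Sxx') (Sxx' ^ 2) V

/-- `f` is a contrastive inverse regression loss with parameter `α`. -/
inductive IsLoss (α : ℝ) : (Matrix (Fin p) (Fin d) ℝ → ℝ) → Prop
  /-- The population loss, for laws `P` of the foreground pair `(x, y)` and `P'` of the background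
  pair, both square integrable and centered in `x` and with nonsingular covariance. -/
  | population (P P' : Measure (EuclideanSpace ℝ (Fin p) × ℝ))
      [IsProbabilityMeasure P] [IsProbabilityMeasure P']
      (hP : MemLp Prod.fst 2 P) (hP' : MemLp Prod.fst 2 P')
      (hc : ∫ z, z.1 ∂P = 0) (hc' : ∫ z, z.1 ∂P' = 0)
      (hcov : (covMat P).PosDef) (hcov' : (covMat P').PosDef) :
      IsLoss α (fun V => sirLoss P V - α * sirLoss P' V)
  /-- The matrix form of the loss, for arbitrary positive definite `Σ_xx` and positive
  semidefinite `Σ_x`: the population matrices `Cov(x)`, `Cov(E[x | y])` and their plug-in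
  estimates `n⁻¹ ∑ xᵢ xᵢᵀ`, `∑ₕ mₕ mₕᵀ` are instances. -/
  | matrixForm (Sxx Sx Sxx' Sx' : Matrix (Fin p) (Fin p) ℝ)
      (hxx : Sxx.PosDef) (hx : Sx.PosSemidef) (hxx' : Sxx'.PosDef) (hx' : Sx'.PosSemidef) :
      IsLoss α (traceLoss Sxx Sx Sxx' Sx' α)

/-! ### Stiefel manifold, gradient, Lagrangian -/

/-- The Stiefel manifold `St(p, d)`. -/
def stiefel (p d : ℕ) : Set (Matrix (Fin p) (Fin d) ℝ) := {V | Vᵀ * V = 1}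

/-- `Q` is an orthogonal projection of `X` to the Stiefel manifold:
`Q ∈ argmin_{Q ∈ St(p, d)} ‖X - Q‖_F`. -/
def IsProj (X Q : Matrix (Fin p) (Fin d) ℝ) : Prop :=
  Q ∈ stiefel p d ∧ ∀ Q' ∈ stiefel p d, ‖X - Q‖ ≤ ‖X - Q'‖

/-- The matrix `∇f(V)` of partial derivatives `∂f/∂V_{ij}`. -/
def grad (f : Matrix (Fin p) (Fin d) ℝ → ℝ) (V : Matrix (Fin p) (Fin d) ℝ) :
    Matrix (Fin p) (Fin d) ℝ :=
  Matrix.of fun i j => fderiv ℝ f V (Matrix.single i j 1)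

/-- `D_V L(V, Λ) = ∇f(V) - V Λ`, the gradient in `V` of the Lagrangian
`L(V, Λ) = f(V) - ½⟨Λ, VᵀV - I⟩` for symmetric `Λ`. -/
def lagrangianGrad (f : Matrix (Fin p) (Fin d) ℝ → ℝ) (V : Matrix (Fin p) (Fin d) ℝ)
    (Λ : Matrix (Fin d) (Fin d) ℝ) : Matrix (Fin p) (Fin d) ℝ :=
  grad f V - V * Λ

/-- The multiplier `Λ(V) = ∇f(V)ᵀ V` that belongs to a point `V`. -/
def multiplier (f : Matrix (Fin p) (Fin d) ℝ → ℝ) (V : Matrix (Fin p) (Fin d) ℝ) :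
    Matrix (Fin d) (Fin d) ℝ :=
  (grad f V)ᵀ * V

/-- The KKT conditions for minimizing `f` subject to `VᵀV = I`. -/
def IsKKT (f : Matrix (Fin p) (Fin d) ℝ → ℝ) (V : Matrix (Fin p) (Fin d) ℝ) : Prop :=
  (∃ Λ : Matrix (Fin d) (Fin d) ℝ, Λ.IsSymm ∧ lagrangianGrad f V Λ = 0) ∧ Vᵀ * V = 1

/-! ### The scaled gradient projection method -/

/-- `∇f(V) Vᵀ - V ∇f(V)ᵀ`. -/
def skewGrad (f : Matrix (Fin p) (Fin d) ℝ → ℝ) (V : Matrix (Fin p) (Fin d) ℝ) :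
    Matrix (Fin p) (Fin p) ℝ :=
  grad f V * Vᵀ - V * (grad f V)ᵀ

/-- The scaling matrix `D_{μ,τ} = (I + μ τ A)⁻¹` with `A = ∇f(V) Vᵀ - V ∇f(V)ᵀ`. It is a genuine
inverse, since `A` is skew-symmetric. -/
def scaling (f : Matrix (Fin p) (Fin d) ℝ → ℝ) (V : Matrix (Fin p) (Fin d) ℝ) (μ τ : ℝ) :
    Matrix (Fin p) (Fin p) ℝ :=
  (1 + (μ * τ) • skewGrad f V)⁻¹

/-- The search curve `Y(τ) = V - τ D_{μ,τ} ∇f(V)`. -/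
def searchCurve (f : Matrix (Fin p) (Fin d) ℝ → ℝ) (V : Matrix (Fin p) (Fin d) ℝ) (μ τ : ℝ) :
    Matrix (Fin p) (Fin d) ℝ :=
  V - τ • (scaling f V μ τ * grad f V)

/-- The sufficient decrease condition `f(Y(τ)) ≤ C + ρ₁ τ Df(V)[Y'(0)]`. -/
def Armijo (f : Matrix (Fin p) (Fin d) ℝ → ℝ) (V : Matrix (Fin p) (Fin d) ℝ)
    (C ρ₁ μ τ : ℝ) : Prop :=
  f (searchCurve f V μ τ) ≤ C + ρ₁ * τ * fderiv ℝ f V (deriv (searchCurve f V μ) 0)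

/-- `Q₀ = 1`, `Q_{k+1} = η Q_k + 1`. -/
def weight (η : ℝ) : ℕ → ℝ
  | 0 => 1
  | k + 1 => η * weight η k + 1

/-- `C₀ = f(V₀)`, `C_{k+1} = (η Q_k C_k + f(V_{k+1})) / Q_{k+1}`. -/
def refValue (f : Matrix (Fin p) (Fin d) ℝ → ℝ) (η : ℝ) (V : ℕ → Matrix (Fin p) (Fin d) ℝ) :
    ℕ → ℝ
  | 0 => f (V 0)
  | k + 1 => (η * weight η k * refValue f η V k + f (V (k + 1))) / weight η (k + 1)

/-- One step from `V` to `V'` with reference value `C`: starting from a trial step size `t` in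
`[τm, τM]`, multiply by `δ` until the sufficient decrease condition holds, then project. The
scaling parameter `μ ∈ [0, 1]` and the trial step size are free in every step, so that every rule
for updating them within these bounds is covered. -/
def Step (f : Matrix (Fin p) (Fin d) ℝ → ℝ) (ρ₁ δ τm τM C : ℝ)
    (V V' : Matrix (Fin p) (Fin d) ℝ) : Prop :=
  ∃ μ ∈ Set.Icc (0 : ℝ) 1, ∃ t ∈ Set.Icc τm τM, ∃ j : ℕ,
    Armijo f V C ρ₁ μ (t * δ ^ j) ∧ (∀ i < j, ¬ Armijo f V C ρ₁ μ (t * δ ^ i)) ∧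
      IsProj (searchCurve f V μ (t * δ ^ j)) V'

/-- `V₀, V₁, …` is an infinite sequence generated by the method (run without a stopping test). -/
def IsSGPMSequence (f : Matrix (Fin p) (Fin d) ℝ → ℝ) (η ρ₁ δ τm τM : ℝ)
    (V : ℕ → Matrix (Fin p) (Fin d) ℝ) : Prop :=
  V 0 ∈ stiefel p d ∧ ∀ k, Step f ρ₁ δ τm τM (refValue f η V k) (V k) (V (k + 1))

end CIR

end

namespace CIR

variable {p d : ℕ}

/-! ### Matrices of full column rank and the Frobenius norm -/

/-! Every loss is, at full column rank, C¹ and a function of the column space alone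
(`IsSmoothInvariant`); for the population loss this follows by integrating an orthogonal-projector
formula for the distance (`sirLoss_eq`).

Invariance makes the constraint harmless. The derivative vanishes along `V * E`, so `(grad f V)ᵀ * V
= 0`: the multiplier is zero on the Stiefel manifold, and it suffices to show `grad f (V k) → 0`.
The projection is the polar factor `X * M` (`IsProj.exists_eq_mul`), so it does not change `f`, and
the sufficient decrease at the trial point passes to `V (k + 1)`.

The reference values then decrease and are bounded below, so `τ_k ‖grad f (V k)‖² → 0`. Were the
gradient nonzero at a subsequential limit, `τ_k → 0` there, so the steps `τ_k / δ` were rejected; in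
the limit this contradicts `ρ₁ < 1`. Compactness gives the whole sequence. -/

lemma norm_sq_eq_trace (V : Matrix (Fin p) (Fin d) ℝ) : ‖V‖ ^ 2 = (Vᵀ * V).trace := by
  rw [Matrix.frobenius_norm_def, ← Real.sqrt_eq_rpow, Real.sq_sqrt (by positivity),
    Finset.sum_comm]
  simp [Matrix.trace, Matrix.mul_apply, sq]

lemma posDef_conj {B : Matrix (Fin p) (Fin p) ℝ} (hB : B.PosDef)
    {V : Matrix (Fin p) (Fin d) ℝ} (hV : Function.Injective V.mulVec) :
    (Vᵀ * B * V).PosDef := by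
  simpa using hB.conjTranspose_mul_mul_same hV

lemma posDef_gram {V : Matrix (Fin p) (Fin d) ℝ} (hV : Function.Injective V.mulVec) :
    (Vᵀ * V).PosDef := by
  simpa using posDef_conj (Matrix.PosDef.one (n := Fin p) (R := ℝ)) hV

lemma injective_mulVec_iff_det_gram {V : Matrix (Fin p) (Fin d) ℝ} :
    Function.Injective V.mulVec ↔ (Vᵀ * V).det ≠ 0 := by
  refine ⟨fun h => (posDef_gram h).det_pos.ne', fun h v w hvw => ?_⟩
  have h1 : (Vᵀ * V) *ᵥ v = (Vᵀ * V) *ᵥ w := by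
    rw [← Matrix.mulVec_mulVec, ← Matrix.mulVec_mulVec, hvw]
  exact Matrix.mulVec_injective_of_isUnit
    ((Matrix.isUnit_iff_isUnit_det _).2 (isUnit_iff_ne_zero.2 h)) h1

lemma eventually_injective_mulVec {V : Matrix (Fin p) (Fin d) ℝ}
    (hV : Function.Injective V.mulVec) :
    ∀ᶠ W in 𝓝 V, Function.Injective (W : Matrix (Fin p) (Fin d) ℝ).mulVec := by
  simp only [injective_mulVec_iff_det_gram] at hV ⊢
  have hc : Continuous fun W : Matrix (Fin p) (Fin d) ℝ => (Wᵀ * W).det := by fun_prop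
  exact hc.continuousAt.eventually_ne hV

lemma injective_mulVec_of_mem_stiefel {V : Matrix (Fin p) (Fin d) ℝ} (hV : V ∈ stiefel p d) :
    Function.Injective V.mulVec := by
  have h : Vᵀ * V = 1 := hV
  simp [injective_mulVec_iff_det_gram, h]

lemma isBoundedBilinearMap_mul {m n k : ℕ} :
    IsBoundedBilinearMap ℝ
      (fun q : Matrix (Fin m) (Fin n) ℝ × Matrix (Fin n) (Fin k) ℝ => q.1 * q.2) where
  add_left _ _ _ := Matrix.add_mul _ _ _
  smul_left _ _ _ := Matrix.smul_mul _ _ _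
  add_right _ _ _ := Matrix.mul_add _ _ _
  smul_right _ _ _ := Matrix.mul_smul _ _ _
  bound := ⟨1, one_pos, fun x y => by simpa using Matrix.frobenius_norm_mul x y⟩

lemma contDiff_quadratic (A : Matrix (Fin p) (Fin p) ℝ) :
    ContDiff ℝ 1 (fun V : Matrix (Fin p) (Fin d) ℝ => Vᵀ * A * V) := by
  have ht : ContDiff ℝ 1 (fun V : Matrix (Fin p) (Fin d) ℝ => Vᵀ) :=
    (LinearMap.toContinuousLinearMap
      (Matrix.transposeLinearEquiv (Fin p) (Fin d) ℝ ℝ).toLinearMap).contDiff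
  exact isBoundedBilinearMap_mul.contDiff.comp
    ((isBoundedBilinearMap_mul.contDiff.comp (ht.prodMk contDiff_const)).prodMk contDiff_id)

section Inverse

attribute [local instance] Matrix.frobeniusNormedRing Matrix.frobeniusNormedAlgebra

lemma contDiffAt_matrix_inv {W : Matrix (Fin d) (Fin d) ℝ} (h : IsUnit W) :
    ContDiffAt ℝ 1 (fun W : Matrix (Fin d) (Fin d) ℝ => W⁻¹) W := by
  have := contDiffAt_ringInverse (n := 1) ℝ h.unit
  simpa [funext Matrix.nonsing_inv_eq_ringInverse] using this

end Inverse

/-! ### Regularity and invariance of the loss -/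

lemma contDiffAt_traceRatio (A : Matrix (Fin p) (Fin p) ℝ) {B : Matrix (Fin p) (Fin p) ℝ}
    (hB : B.PosDef) {V : Matrix (Fin p) (Fin d) ℝ} (hV : Function.Injective V.mulVec) :
    ContDiffAt ℝ 1 (traceRatio A B) V := by
  have hi : ContDiffAt ℝ 1 (fun V : Matrix (Fin p) (Fin d) ℝ => (Vᵀ * B * V)⁻¹) V :=
    ContDiffAt.comp V (contDiffAt_matrix_inv (posDef_conj hB hV).isUnit)
      (contDiff_quadratic B).contDiffAt
  have hm : ContDiffAt ℝ 1 (fun V : Matrix (Fin p) (Fin d) ℝ => Vᵀ * A * V * (Vᵀ * B * V)⁻¹) V :=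
    ContDiffAt.comp V isBoundedBilinearMap_mul.contDiff.contDiffAt
      ((contDiff_quadratic A).contDiffAt.prodMk hi)
  exact ContDiffAt.comp V (LinearMap.toContinuousLinearMap
    (Matrix.traceLinearMap (Fin d) ℝ ℝ)).contDiff.contDiffAt hm

/-- Both quadratic forms undergo the congruence by `M`, so the product of one with the inverse of
the other changes by a similarity, which the trace ignores. -/
lemma traceRatio_mul_right (A B : Matrix (Fin p) (Fin p) ℝ) (V : Matrix (Fin p) (Fin d) ℝ)
    {M : Matrix (Fin d) (Fin d) ℝ} (hM : IsUnit M.det) :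
    traceRatio A B (V * M) = traceRatio A B V := by
  have hMt : IsUnit Mᵀ.det := by rwa [Matrix.det_transpose]
  have h : (V * M)ᵀ * A * (V * M) * ((V * M)ᵀ * B * (V * M))⁻¹
      = Mᵀ * (Vᵀ * A * V * (Vᵀ * B * V)⁻¹ * Mᵀ⁻¹) := by
    have e : ∀ C : Matrix (Fin p) (Fin p) ℝ,
        (V * M)ᵀ * C * (V * M) = Mᵀ * ((Vᵀ * C * V) * M) := fun C => by
      simp only [Matrix.transpose_mul, Matrix.mul_assoc]
    rw [e, e, Matrix.mul_inv_rev, Matrix.mul_inv_rev]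
    simp only [Matrix.mul_assoc]
    rw [Matrix.mul_nonsing_inv_cancel_left _ _ hM]
  rw [traceRatio, h, Matrix.trace_mul_comm, Matrix.mul_assoc, Matrix.nonsing_inv_mul _ hMt,
    Matrix.mul_one, traceRatio]

lemma posDef_sq {S : Matrix (Fin p) (Fin p) ℝ} (hS : S.PosDef) : (S ^ 2).PosDef := by
  have h : Sᵀ = S := by simpa using hS.isHermitian.eq
  have := posDef_gram (Matrix.mulVec_injective_of_isUnit hS.isUnit)
  rwa [h, ← sq] at this

/-- Least squares: the nearest point is `U (UᵀU)⁻¹ Uᵀ x`. The entrywise expansion lets an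
expectation act on the products `x i * x j`. -/
lemma infDist_colSpace_sq {U : Matrix (Fin p) (Fin d) ℝ} (hU : Function.Injective U.mulVec)
    (x : EuclideanSpace ℝ (Fin p)) :
    Metric.infDist x (colSpace U : Set (EuclideanSpace ℝ (Fin p))) ^ 2
      = ∑ i, x i * x i - ∑ i, ∑ j, (U * (Uᵀ * U)⁻¹ * Uᵀ) i j * (x i * x j) := by
  have hdet : IsUnit (Uᵀ * U).det := (posDef_gram hU).det_pos.ne'.isUnit
  set y : EuclideanSpace ℝ (Fin d) := WithLp.toLp 2 (((Uᵀ * U)⁻¹ * Uᵀ) *ᵥ x.ofLp) with hy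
  have hq : Matrix.toEuclideanLin U y ∈ colSpace U := ⟨y, rfl⟩
  have horth : ∀ w ∈ colSpace U, inner ℝ (x - Matrix.toEuclideanLin U y) w = 0 := by
    rintro _ ⟨w, rfl⟩
    have h0 : Uᵀ *ᵥ (x.ofLp - U *ᵥ y.ofLp) = 0 := by
      rw [Matrix.mulVec_sub, hy, Matrix.mulVec_mulVec, Matrix.mulVec_mulVec,
        ← Matrix.mul_assoc, Matrix.mul_nonsing_inv _ hdet, Matrix.one_mul, sub_self]
    rw [EuclideanSpace.inner_eq_star_dotProduct]
    simp only [Matrix.ofLp_toLpLin, Matrix.toLin'_apply, WithLp.ofLp_sub, star_trivial]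
    rw [dotProduct_comm, Matrix.dotProduct_mulVec, ← Matrix.mulVec_transpose, h0, zero_dotProduct]
  have hnorm := ((colSpace U).norm_eq_iInf_iff_real_inner_eq_zero hq).2 horth
  have hd : Metric.infDist x (colSpace U : Set (EuclideanSpace ℝ (Fin p)))
      = ‖x - Matrix.toEuclideanLin U y‖ := by
    rw [hnorm, Metric.infDist_eq_iInf]
    simp only [dist_eq_norm]
  have h1 : ‖x - Matrix.toEuclideanLin U y‖ ^ 2
      = inner ℝ x x - inner ℝ (Matrix.toEuclideanLin U y) x := by
    rw [← real_inner_self_eq_norm_sq, inner_sub_right, horth _ hq, inner_sub_left, sub_zero]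
  have h2 : inner ℝ x x = ∑ i, x i * x i := by
    rw [EuclideanSpace.inner_eq_star_dotProduct]
    rfl
  have h3 : inner ℝ (Matrix.toEuclideanLin U y) x
      = ∑ i, ∑ j, (U * (Uᵀ * U)⁻¹ * Uᵀ) i j * (x i * x j) := by
    rw [real_inner_comm, EuclideanSpace.inner_eq_star_dotProduct]
    simp only [Matrix.ofLp_toLpLin, Matrix.toLin'_apply, star_trivial, hy, Matrix.mulVec_mulVec,
      ← Matrix.mul_assoc]
    simp only [dotProduct, Matrix.mulVec, Finset.sum_mul]
    exact Finset.sum_congr rfl fun i _ => Finset.sum_congr rfl fun j _ => by ring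
  rw [hd, h1, h2, h3]

/-- The matrix `E[v vᵀ]` of second moments of the inverse regression curve `v = E[x | y]`. -/
noncomputable def secondMoment (P : Measure (EuclideanSpace ℝ (Fin p) × ℝ)) :
    Matrix (Fin p) (Fin p) ℝ :=
  Matrix.of fun i j => ∫ z, inverseRegression P z i * inverseRegression P z j ∂P

/-- The projector onto the column space is deterministic, so only second moments of `E[x | y]`
survive integration; symmetry of the covariance and cyclicity of the trace do the rest. -/
lemma sirLoss_eq {P : Measure (EuclideanSpace ℝ (Fin p) × ℝ)} (hP : MemLp Prod.fst 2 P)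
    (hcov : (covMat P).PosDef) {V : Matrix (Fin p) (Fin d) ℝ}
    (hV : Function.Injective V.mulVec) :
    sirLoss P V = (secondMoment P).trace
      - traceRatio (covMat P * secondMoment P * covMat P) (covMat P ^ 2) V := by
  have hsym : (covMat P)ᵀ = covMat P := by simpa using hcov.isHermitian.eq
  have hm : MemLp (inverseRegression P) 2 P := MemLp.condExp one_le_two hP
  have hmi : ∀ i, MemLp (fun z => inverseRegression P z i) 2 P := fun i =>
    (EuclideanSpace.proj (𝕜 := ℝ) i).comp_memLp' hm
  have hint : ∀ i j, Integrable
      (fun z => inverseRegression P z i * inverseRegression P z j) P := fun i j =>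
    (hmi i).integrable_mul (hmi j)
  have hU : Function.Injective (covMat P * V).mulVec := by
    intro v w hvw
    simp only [← Matrix.mulVec_mulVec] at hvw
    exact hV (Matrix.mulVec_injective_of_isUnit hcov.isUnit hvw)
  set W := covMat P * V * ((covMat P * V)ᵀ * (covMat P * V))⁻¹ * (covMat P * V)ᵀ with hW
  have hsum : sirLoss P V = (secondMoment P).trace - (W * secondMoment P).trace := by
    have hs : ∀ i j, secondMoment P i j = secondMoment P j i := fun i j => by
      simp only [secondMoment, Matrix.of_apply, mul_comm]
    simp only [sirLoss, infDist_colSpace_sq hU, ← hW]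
    have hrow : ∀ i, Integrable (fun z => ∑ j, W i j *
        (inverseRegression P z i * inverseRegression P z j)) P := fun i =>
      integrable_finsetSum _ fun j _ => (hint i j).const_mul _
    refine (integral_sub (integrable_finsetSum _ fun i _ => hint i i)
      (integrable_finsetSum _ fun i _ => hrow i)).trans ?_
    rw [integral_finsetSum _ fun i _ => hint i i, integral_finsetSum _ fun i _ => hrow i]
    congr 1
    simp only [Matrix.trace, Matrix.diag, Matrix.mul_apply]
    refine Finset.sum_congr rfl fun i _ => ?_
    refine (integral_finsetSum _ fun j _ => (hint i j).const_mul _).trans ?_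
    refine Finset.sum_congr rfl fun j _ => ?_
    rw [integral_const_mul, hs j i]
    rfl
  rw [hsum, traceRatio, hW, Matrix.transpose_mul, hsym]
  congr 1
  have e1 : Vᵀ * covMat P * (covMat P * V) = Vᵀ * covMat P ^ 2 * V := by
    simp only [sq, Matrix.mul_assoc]
  rw [e1, Matrix.trace_mul_comm (Vᵀ * _ * V)]
  generalize (Vᵀ * covMat P ^ 2 * V)⁻¹ = R
  simp only [Matrix.mul_assoc]
  rw [← Matrix.mul_assoc, Matrix.trace_mul_comm]
  simp only [Matrix.mul_assoc]

/-- On matrices of full column rank every loss agrees with a matrix form up to a constant. -/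
lemma IsLoss.exists_eq_traceLoss {α : ℝ} {f : Matrix (Fin p) (Fin d) ℝ → ℝ} (hf : IsLoss α f) :
    ∃ (Sxx Sx Sxx' Sx' : Matrix (Fin p) (Fin p) ℝ) (c : ℝ), Sxx.PosDef ∧ Sxx'.PosDef ∧
      ∀ V, Function.Injective V.mulVec → f V = c + traceLoss Sxx Sx Sxx' Sx' α V := by
  cases hf with
  | population P P' hP hP' hc hc' hcov hcov' =>
    refine ⟨covMat P, secondMoment P, covMat P', secondMoment P',
      (secondMoment P).trace - α * (secondMoment P').trace, hcov, hcov', fun V hV => ?_⟩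
    beta_reduce
    rw [sirLoss_eq hP hcov hV, sirLoss_eq hP' hcov' hV, traceLoss]
    ring
  | matrixForm Sxx Sx Sxx' Sx' hxx hx hxx' hx' =>
    exact ⟨Sxx, Sx, Sxx', Sx', 0, hxx, hxx', fun V _ => by rw [zero_add]⟩

/-- A function that is continuously differentiable on the matrices of full column rank and
depends only on the column space. -/
structure IsSmoothInvariant (f : Matrix (Fin p) (Fin d) ℝ → ℝ) : Prop where
  contDiffAt : ∀ V, Function.Injective V.mulVec → ContDiffAt ℝ 1 f V
  mul_right : ∀ V (M : Matrix (Fin d) (Fin d) ℝ), Function.Injective V.mulVec → IsUnit M.det →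
    f (V * M) = f V

lemma IsLoss.isSmoothInvariant {α : ℝ} {f : Matrix (Fin p) (Fin d) ℝ → ℝ} (hf : IsLoss α f) :
    IsSmoothInvariant f := by
  obtain ⟨Sxx, Sx, Sxx', Sx', c, h, h', heq⟩ := hf.exists_eq_traceLoss
  refine ⟨fun V hV => ?_, fun V M hV hM => ?_⟩
  · have : ContDiffAt ℝ 1 (fun V => c + traceLoss Sxx Sx Sxx' Sx' α V) V :=
      contDiffAt_const.add ((contDiffAt_traceRatio _ (posDef_sq h) hV).neg.add
        (contDiffAt_const.mul (contDiffAt_traceRatio _ (posDef_sq h') hV)))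
    -- The trace formula is known only at full column rank, which is an open condition.
    exact this.congr_of_eventuallyEq ((eventually_injective_mulVec hV).mono heq)
  · have hVM : Function.Injective (V * M).mulVec := by
      intro v w hvw
      simp only [← Matrix.mulVec_mulVec] at hvw
      exact Matrix.mulVec_injective_of_isUnit ((Matrix.isUnit_iff_isUnit_det _).2 hM) (hV hvw)
    rw [heq _ hVM, heq _ hV, traceLoss, traceLoss, traceRatio_mul_right _ _ _ hM,
      traceRatio_mul_right _ _ _ hM]

/-! ### Projection to the Stiefel manifold -/

open scoped MatrixOrder in
lemma exists_posDef_sq_eq {S : Matrix (Fin d) (Fin d) ℝ} (hS : S.PosDef) :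
    ∃ R : Matrix (Fin d) (Fin d) ℝ, R.PosDef ∧ R * R = S :=
  ⟨CFC.sqrt S, (IsStrictlyPositive.sqrt S hS.isStrictlyPositive).posDef,
    CFC.sqrt_mul_sqrt_self S hS.posSemidef.nonneg⟩

/-- Projecting `X` thus amounts to maximizing `tr(QᵀX)`. -/
lemma norm_sub_sq_of_mem_stiefel (X : Matrix (Fin p) (Fin d) ℝ) {Q : Matrix (Fin p) (Fin d) ℝ}
    (hQ : Q ∈ stiefel p d) :
    ‖X - Q‖ ^ 2 = (Xᵀ * X).trace + (1 : Matrix (Fin d) (Fin d) ℝ).trace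
      - 2 * (Qᵀ * X).trace := by
  have hQ' : Qᵀ * Q = 1 := hQ
  have ht : (Xᵀ * Q).trace = (Qᵀ * X).trace := by
    rw [← Matrix.trace_transpose, Matrix.transpose_mul, Matrix.transpose_transpose]
  rw [norm_sq_eq_trace, Matrix.transpose_sub, Matrix.sub_mul, Matrix.mul_sub, Matrix.mul_sub, hQ']
  simp only [Matrix.trace_sub, ht]
  ring

/-- A projection to the Stiefel manifold keeps the column space: it is the polar factor. -/
lemma IsProj.exists_eq_mul {X Q : Matrix (Fin p) (Fin d) ℝ} (hX : Function.Injective X.mulVec)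
    (hQ : IsProj X Q) : ∃ M : Matrix (Fin d) (Fin d) ℝ, IsUnit M.det ∧ Q = X * M := by
  -- `P = (XᵀX)^(1/2)` is the polar modulus; its root `R` turns weighted traces into norms.
  obtain ⟨P, hP, hPS⟩ := exists_posDef_sq_eq (posDef_gram hX)
  obtain ⟨R, hR, hRP⟩ := exists_posDef_sq_eq hP
  have hPu : IsUnit P.det := hP.det_pos.ne'.isUnit
  have hRu : IsUnit R.det := hR.det_pos.ne'.isUnit
  have hPt : Pᵀ = P := by simpa using hP.isHermitian.eq
  have hRt : Rᵀ = R := by simpa using hR.isHermitian.eq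
  set U := X * P⁻¹ with hU
  have hUP : U * P = X := by rw [hU, Matrix.nonsing_inv_mul_cancel_right _ _ hPu]
  have hUU : Uᵀ * U = 1 := by
    rw [hU, Matrix.transpose_mul, Matrix.transpose_nonsing_inv, hPt, Matrix.mul_assoc,
      ← Matrix.mul_assoc Xᵀ, ← hPS, Matrix.mul_assoc P, Matrix.mul_nonsing_inv _ hPu,
      Matrix.mul_one, Matrix.nonsing_inv_mul _ hPu]
  have hQQ : Qᵀ * Q = 1 := hQ.1
  have hUX : Uᵀ * X = P := by rw [← hUP, ← Matrix.mul_assoc, hUU, Matrix.one_mul]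
  have hle : P.trace ≤ (Qᵀ * X).trace := by
    have h := pow_le_pow_left₀ (norm_nonneg _) (hQ.2 U hUU) 2
    rw [norm_sub_sq_of_mem_stiefel X hQ.1, norm_sub_sq_of_mem_stiefel X hUU, hUX] at h
    linarith
  have hQU : ((Qᵀ * U) * P).trace = (Qᵀ * X).trace := by rw [Matrix.mul_assoc, hUP]
  have hUQ : ((Uᵀ * Q) * P).trace = (Qᵀ * X).trace := by
    rw [← Matrix.trace_transpose, Matrix.transpose_mul, Matrix.transpose_mul, hPt,
      Matrix.transpose_transpose, Matrix.trace_mul_comm, hQU]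
  -- Together with `hle` this makes the weighted distance from `Q` to the polar factor `U`
  -- nonpositive, so `Q = U`.
  have hnorm : ‖(Q - U) * R‖ ^ 2 = 2 * P.trace - 2 * (Qᵀ * X).trace := by
    have h1 : (((Q - U) * R)ᵀ * ((Q - U) * R)).trace = ((Q - U)ᵀ * (Q - U) * P).trace := by
      rw [Matrix.transpose_mul, hRt, Matrix.mul_assoc, Matrix.trace_mul_comm, ← hRP]
      simp only [Matrix.mul_assoc]
    rw [norm_sq_eq_trace, h1, Matrix.transpose_sub]
    simp only [Matrix.sub_mul, Matrix.mul_sub, Matrix.trace_sub, hQQ, hUU, Matrix.one_mul, hQU, hUQ]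
    ring
  have hz : (Q - U) * R = 0 := by
    have : ‖(Q - U) * R‖ ^ 2 ≤ 0 := by rw [hnorm]; linarith
    exact norm_eq_zero.1 (pow_eq_zero_iff two_ne_zero |>.1 (le_antisymm this (sq_nonneg _)))
  refine ⟨P⁻¹, by simpa using hPu, ?_⟩
  have h0 : (Q - U) * R * R⁻¹ = 0 := by rw [hz, Matrix.zero_mul]
  rw [Matrix.mul_nonsing_inv_cancel_right _ _ hRu] at h0
  exact sub_eq_zero.1 h0

lemma isCompact_stiefel (p d : ℕ) : IsCompact (stiefel p d) := by
  refine Metric.isCompact_of_isClosed_isBounded ?_ ?_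
  · have hc : Continuous fun W : Matrix (Fin p) (Fin d) ℝ => Wᵀ * W := by fun_prop
    exact isClosed_singleton.preimage hc
  · refine (Metric.isBounded_iff_subset_closedBall 0).2 ⟨√d, fun V hV => ?_⟩
    have h : Vᵀ * V = 1 := hV
    rw [mem_closedBall_zero_iff]
    refine Real.le_sqrt_of_sq_le ?_
    simp [norm_sq_eq_trace, h]

/-! ### The gradient of an invariant function -/

lemma fderiv_eq_trace (f : Matrix (Fin p) (Fin d) ℝ → ℝ) (V H : Matrix (Fin p) (Fin d) ℝ) :
    fderiv ℝ f V H = ((grad f V)ᵀ * H).trace := by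
  conv_lhs => rw [Matrix.matrix_eq_sum_single H]
  simp only [map_sum, Matrix.trace, Matrix.diag, Matrix.mul_apply, Matrix.transpose_apply, grad,
    Matrix.of_apply]
  rw [Finset.sum_comm]
  refine Finset.sum_congr rfl fun j _ => Finset.sum_congr rfl fun i _ => ?_
  have : Matrix.single i j (H i j) = H i j • Matrix.single i j (1 : ℝ) := by
    simp [Matrix.smul_single]
  rw [this, map_smul, smul_eq_mul, mul_comm]

lemma fderiv_grad (f : Matrix (Fin p) (Fin d) ℝ → ℝ) (V : Matrix (Fin p) (Fin d) ℝ) :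
    fderiv ℝ f V (grad f V) = ‖grad f V‖ ^ 2 := by
  rw [fderiv_eq_trace, norm_sq_eq_trace]

variable {f : Matrix (Fin p) (Fin d) ℝ → ℝ}

/-- For small `t` the matrix `1 + t • E` is invertible, so `f` is constant along `V * (1 + t • E)`.
-/
lemma IsSmoothInvariant.fderiv_mul_right (hf : IsSmoothInvariant f)
    {V : Matrix (Fin p) (Fin d) ℝ} (hV : Function.Injective V.mulVec)
    (E : Matrix (Fin d) (Fin d) ℝ) : fderiv ℝ f V (V * E) = 0 := by
  have hd : HasFDerivAt f (fderiv ℝ f V) V :=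
    ((hf.contDiffAt V hV).differentiableAt one_ne_zero).hasFDerivAt
  have hline : HasDerivAt (fun t : ℝ => V + t • (V * E)) (V * E) 0 := by
    have h := ((hasDerivAt_id (0 : ℝ)).smul_const (V * E)).const_add V
    rw [one_smul] at h
    exact h
  have hcomp : HasDerivAt (fun t : ℝ => f (V + t • (V * E))) (fderiv ℝ f V (V * E)) 0 := by
    refine HasFDerivAt.comp_hasDerivAt (0 : ℝ) ?_ hline
    rw [zero_smul, add_zero]
    exact hd
  have hconst : (fun t : ℝ => f (V + t • (V * E))) =ᶠ[𝓝 0] fun _ => f V := by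
    have hc : Continuous fun t : ℝ => (1 + t • E : Matrix (Fin d) (Fin d) ℝ).det := by fun_prop
    have hne : ∀ᶠ t in 𝓝 (0 : ℝ), (1 + t • E : Matrix (Fin d) (Fin d) ℝ).det ≠ 0 :=
      hc.continuousAt.eventually_ne (by simp)
    filter_upwards [hne] with t ht
    rw [← hf.mul_right V _ hV ht.isUnit, Matrix.mul_add, Matrix.mul_one, Matrix.mul_smul]
  exact hcomp.unique ((hasDerivAt_const (0 : ℝ) (f V)).congr_of_eventuallyEq hconst)

lemma IsSmoothInvariant.grad_transpose_mul (hf : IsSmoothInvariant f)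
    {V : Matrix (Fin p) (Fin d) ℝ} (hV : Function.Injective V.mulVec) :
    (grad f V)ᵀ * V = 0 := by
  -- With this choice of `E` the vanishing derivative equals `‖Vᵀ * grad f V‖ ^ 2`.
  have h := hf.fderiv_mul_right hV (Vᵀ * grad f V)
  rw [fderiv_eq_trace, ← Matrix.mul_assoc] at h
  have h2 : ‖Vᵀ * grad f V‖ ^ 2 = 0 := by
    rw [norm_sq_eq_trace, Matrix.transpose_mul, Matrix.transpose_transpose, h]
  have h3 : Vᵀ * grad f V = 0 := norm_eq_zero.1 (pow_eq_zero_iff two_ne_zero |>.1 h2)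
  simpa using congrArg Matrix.transpose h3

lemma IsSmoothInvariant.continuousAt_grad (hf : IsSmoothInvariant f)
    {V : Matrix (Fin p) (Fin d) ℝ} (hV : Function.Injective V.mulVec) :
    ContinuousAt (grad f) V := by
  have h : ContinuousAt (fderiv ℝ f) V :=
    ((hf.contDiffAt V hV).fderiv_right (m := 0) (by norm_num)).continuousAt
  refine continuousAt_pi.2 fun i => continuousAt_pi.2 fun j => ?_
  exact h.clm_apply continuousAt_const

/-! ### The search curve -/

lemma skewGrad_transpose (f : Matrix (Fin p) (Fin d) ℝ → ℝ) (V : Matrix (Fin p) (Fin d) ℝ) :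
    (skewGrad f V)ᵀ = -skewGrad f V := by
  simp [skewGrad]

/-- Skewness gives `xᵀAx = 0`, so pairing `(1 + cA)x = 0` with `x` leaves `xᵀx = 0`. -/
lemma isUnit_one_add_smul_of_skew {A : Matrix (Fin p) (Fin p) ℝ} (hA : Aᵀ = -A) (c : ℝ) :
    IsUnit (1 + c • A) := by
  rw [← Matrix.mulVec_injective_iff_isUnit]
  refine (injective_iff_map_eq_zero (1 + c • A).mulVecLin).2 fun x hx => ?_
  rw [Matrix.mulVecLin_apply, Matrix.add_mulVec, Matrix.one_mulVec, Matrix.smul_mulVec] at hx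
  have hskew : x ⬝ᵥ A *ᵥ x = 0 := by
    have h : x ⬝ᵥ A *ᵥ x = -(x ⬝ᵥ A *ᵥ x) := by
      conv_lhs => rw [Matrix.dotProduct_mulVec, ← Matrix.mulVec_transpose, hA, Matrix.neg_mulVec,
        neg_dotProduct, dotProduct_comm]
    linarith
  have h := congrArg (x ⬝ᵥ ·) hx
  simp only [dotProduct_add, dotProduct_smul, hskew, smul_zero, add_zero, dotProduct_zero] at h
  exact dotProduct_self_eq_zero.1 h

lemma IsSmoothInvariant.skewGrad_mul (hf : IsSmoothInvariant f) {V : Matrix (Fin p) (Fin d) ℝ}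
    (hV : V ∈ stiefel p d) : skewGrad f V * V = grad f V := by
  have h : Vᵀ * V = 1 := hV
  rw [skewGrad, Matrix.sub_mul, Matrix.mul_assoc, Matrix.mul_assoc, h,
    hf.grad_transpose_mul (injective_mulVec_of_mem_stiefel hV), Matrix.mul_one, Matrix.mul_zero,
    sub_zero]

/-- The search curve never leaves the set of matrices of full column rank. -/
lemma IsSmoothInvariant.injective_searchCurve (hf : IsSmoothInvariant f)
    {V : Matrix (Fin p) (Fin d) ℝ} (hV : V ∈ stiefel p d) (μ τ : ℝ) :
    Function.Injective (searchCurve f V μ τ).mulVec := by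
  have hVV : Vᵀ * V = 1 := hV
  have hG : Vᵀ * grad f V = 0 := by
    simpa using congrArg Matrix.transpose
      (hf.grad_transpose_mul (injective_mulVec_of_mem_stiefel hV))
  have hu : IsUnit (1 + (μ * τ) • skewGrad f V).det :=
    (Matrix.isUnit_iff_isUnit_det _).1
      (isUnit_one_add_smul_of_skew (skewGrad_transpose f V) (μ * τ))
  -- As `skewGrad f V * V = grad f V`, the inner product is `V + (μτ - τ) grad f V`, and `Vᵀ * grad
  -- f V = 0`. This exhibits a left inverse of the search curve.
  have hkey : Vᵀ * ((1 + (μ * τ) • skewGrad f V) * searchCurve f V μ τ) = 1 := by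
    rw [searchCurve, scaling, Matrix.mul_sub, Matrix.mul_smul,
      Matrix.mul_nonsing_inv_cancel_left _ _ hu, Matrix.add_mul, Matrix.one_mul,
      Matrix.smul_mul, hf.skewGrad_mul hV, Matrix.mul_sub, Matrix.mul_add, Matrix.mul_smul,
      Matrix.mul_smul, hG, hVV]
    simp
  intro v w hvw
  have h : ∀ u, (Vᵀ * (1 + (μ * τ) • skewGrad f V)) *ᵥ (searchCurve f V μ τ *ᵥ u) = u := by
    intro u
    rw [Matrix.mulVec_mulVec, Matrix.mul_assoc, hkey, Matrix.one_mulVec]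
  have hvw' : searchCurve f V μ τ *ᵥ v = searchCurve f V μ τ *ᵥ w := hvw
  rw [← h v, hvw', h w]

lemma tendsto_one_add_smul_inv_mul {ι : Type*} {l : Filter ι} {c : ι → ℝ}
    {A : ι → Matrix (Fin p) (Fin p) ℝ} {G : ι → Matrix (Fin p) (Fin d) ℝ}
    {A₀ : Matrix (Fin p) (Fin p) ℝ} {G₀ : Matrix (Fin p) (Fin d) ℝ}
    (hc : Tendsto c l (𝓝 0)) (hA : Tendsto A l (𝓝 A₀)) (hG : Tendsto G l (𝓝 G₀)) :
    Tendsto (fun i => (1 + c i • A i)⁻¹ * G i) l (𝓝 G₀) := by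
  have h1 : Tendsto (fun i => 1 + c i • A i) l (𝓝 1) := by
    simpa using tendsto_const_nhds.add (hc.smul hA)
  have hinv : Tendsto (fun W : Matrix (Fin p) (Fin p) ℝ => W⁻¹) (𝓝 1) (𝓝 1) := by
    have h : ContinuousAt (fun W : Matrix (Fin p) (Fin p) ℝ => W⁻¹) 1 :=
      (contDiffAt_matrix_inv isUnit_one).continuousAt
    simpa [ContinuousAt] using h
  have hmul : Continuous fun q : Matrix (Fin p) (Fin p) ℝ × Matrix (Fin p) (Fin d) ℝ =>
    q.1 * q.2 := by fun_prop
  have h := (hmul.tendsto (1, G₀)).comp ((hinv.comp h1).prodMk_nhds hG)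
  simp only [Matrix.one_mul] at h
  exact h

lemma hasDerivAt_searchCurve (f : Matrix (Fin p) (Fin d) ℝ → ℝ) (V : Matrix (Fin p) (Fin d) ℝ)
    (μ : ℝ) : HasDerivAt (searchCurve f V μ) (-grad f V) 0 := by
  refine hasDerivAt_iff_tendsto_slope.2 ?_
  have hc : Tendsto (fun τ : ℝ => μ * τ) (𝓝[≠] 0) (𝓝 0) := by
    have : Tendsto (fun τ : ℝ => μ * τ) (𝓝 0) (𝓝 (μ * 0)) := tendsto_id.const_mul μ
    rw [mul_zero] at this
    exact this.mono_left nhdsWithin_le_nhds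
  have h : Tendsto (fun τ => -(scaling f V μ τ * grad f V)) (𝓝[≠] 0) (𝓝 (-grad f V)) :=
    (tendsto_one_add_smul_inv_mul hc tendsto_const_nhds tendsto_const_nhds).neg
  refine h.congr' ?_
  filter_upwards [self_mem_nhdsWithin] with τ hτ
  have hτ' : τ ≠ 0 := hτ
  simp [slope, searchCurve, smul_smul, hτ']

lemma armijo_iff {V : Matrix (Fin p) (Fin d) ℝ} {C ρ₁ μ τ : ℝ} :
    Armijo f V C ρ₁ μ τ ↔ f (searchCurve f V μ τ) ≤ C - ρ₁ * τ * ‖grad f V‖ ^ 2 := by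
  have hd : deriv (searchCurve f V μ) 0 = -grad f V := (hasDerivAt_searchCurve f V μ).deriv
  rw [Armijo, hd, map_neg, fderiv_grad, mul_neg, ← sub_eq_add_neg]

/-- Difference quotients along converging base points, directions and step sizes. -/
lemma tendsto_diffQuotient {ι E : Type*} [NormedAddCommGroup E] [NormedSpace ℝ E] {l : Filter ι}
    {g : E → ℝ} {L : E →L[ℝ] ℝ} {x₀ D₀ : E} (hg : HasStrictFDerivAt g L x₀) {x D : ι → E}
    {s : ι → ℝ} (hx : Tendsto x l (𝓝 x₀)) (hD : Tendsto D l (𝓝 D₀)) (hs : Tendsto s l (𝓝 0))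
    (hs0 : ∀ᶠ i in l, s i ≠ 0) :
    Tendsto (fun i => (g (x i - s i • D i) - g (x i)) / s i) l (𝓝 (-L D₀)) := by
  have hsD : Tendsto (fun i => s i • D i) l (𝓝 0) := by simpa using hs.smul hD
  have hy : Tendsto (fun i => x i - s i • D i) l (𝓝 x₀) := by simpa using hx.sub hsD
  -- Strict differentiability is what permits both endpoints to move.
  have ho := hg.isLittleO.comp_tendsto (hy.prodMk_nhds hx)
  have hO : (fun i => x i - s i • D i - x i) =O[l] s := by
    have h1 : (fun i => s i • D i) =O[l] fun i => s i • (1 : ℝ) :=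
      (Asymptotics.isBigO_refl s l).smul (hD.isBigO_one ℝ)
    simpa using h1.neg_left
  have h := (ho.trans_isBigO hO).tendsto_div_nhds_zero
  have hL : Tendsto (fun i => -L (D i)) l (𝓝 (-L D₀)) := ((L.continuous.tendsto D₀).comp hD).neg
  have hsum := h.add hL
  rw [zero_add] at hsum
  refine hsum.congr' ?_
  filter_upwards [hs0] with i hi
  simp only [Function.comp_apply, map_sub, map_smul, smul_eq_mul]
  field_simp
  ring

/-! ### Nonmonotone line search -/

lemma one_le_weight {η : ℝ} (hη : 0 ≤ η) (k : ℕ) : 1 ≤ weight η k := by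
  induction k with
  | zero => exact le_rfl
  | succ k ih => rw [weight]; nlinarith

lemma weight_le {η : ℝ} (hη : η ∈ Set.Ico (0 : ℝ) 1) (k : ℕ) : weight η k ≤ (1 - η)⁻¹ := by
  have h1 : 0 < 1 - η := sub_pos.2 hη.2
  rw [← one_div, le_div_iff₀ h1]
  induction k with
  | zero => rw [weight]; linarith [hη.1]
  | succ k ih => rw [weight]; nlinarith [hη.1]

/-- Since `η Q_k = Q_{k+1} - 1`, the new reference value is a weighted mean of `C_k` and `f (V (k +
1))`. -/
lemma weight_mul_refValue_succ {η : ℝ} (hη : 0 ≤ η) (V : ℕ → Matrix (Fin p) (Fin d) ℝ) (k : ℕ) :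
    weight η (k + 1) * refValue f η V (k + 1)
      = (weight η (k + 1) - 1) * refValue f η V k + f (V (k + 1)) := by
  have h : weight η (k + 1) ≠ 0 := (zero_lt_one.trans_le (one_le_weight hη _)).ne'
  rw [refValue, mul_div_cancel₀ _ h, weight]
  ring

lemma le_refValue {η : ℝ} (hη : 0 ≤ η) {V : ℕ → Matrix (Fin p) (Fin d) ℝ}
    (hdec : ∀ k, f (V (k + 1)) ≤ refValue f η V k) (k : ℕ) : f (V k) ≤ refValue f η V k := by
  cases k with
  | zero => exact le_rfl
  | succ k =>
    have h1 := one_le_weight hη (k + 1)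
    refine le_of_mul_le_mul_left ?_ (zero_lt_one.trans_le h1)
    rw [weight_mul_refValue_succ hη]
    nlinarith [hdec k]

/-- Averaging retains at least the fraction `1 / Q_{k+1} ≥ 1 - η` of each decrease, and the
differences of the convergent sequence `C_k` tend to zero. -/
lemma tendsto_zero_of_sufficient_decrease {η : ℝ} (hη : η ∈ Set.Ico (0 : ℝ) 1)
    {V : ℕ → Matrix (Fin p) (Fin d) ℝ} {b : ℝ} (hb : ∀ k, b ≤ f (V k)) {a : ℕ → ℝ}
    (ha : ∀ k, 0 ≤ a k) (hdec : ∀ k, f (V (k + 1)) ≤ refValue f η V k - a k) :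
    Tendsto a atTop (𝓝 0) := by
  have hle := le_refValue hη.1 fun k => (hdec k).trans (sub_le_self _ (ha k))
  have hstep : ∀ k, a k ≤ weight η (k + 1) * (refValue f η V k - refValue f η V (k + 1)) := by
    intro k
    rw [mul_sub, weight_mul_refValue_succ hη.1]
    linarith [hdec k]
  have hanti : Antitone (refValue f η V) := antitone_nat_of_succ_le fun k => by
    have h := (ha k).trans (hstep k)
    have hw := zero_lt_one.trans_le (one_le_weight hη.1 (k + 1))
    exact sub_nonneg.1 (nonneg_of_mul_nonneg_right h hw)
  have hlim := tendsto_atTop_ciInf hanti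
    ⟨b, by rintro _ ⟨k, rfl⟩; exact (hb k).trans (hle k)⟩
  have hdiff : Tendsto (fun k => (1 - η)⁻¹ * (refValue f η V k - refValue f η V (k + 1)))
      atTop (𝓝 0) := by
    simpa using (hlim.sub (hlim.comp (tendsto_add_atTop_nat 1))).const_mul (1 - η)⁻¹
  refine squeeze_zero ha (fun k => (hstep k).trans ?_) hdiff
  exact mul_le_mul_of_nonneg_right (weight_le hη _) (sub_nonneg.2 (hanti k.le_succ))

/-! ### Convergence -/

lemma IsSGPMSequence.mem_stiefel {η ρ₁ δ τm τM : ℝ} {V : ℕ → Matrix (Fin p) (Fin d) ℝ}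
    (hV : IsSGPMSequence f η ρ₁ δ τm τM V) (k : ℕ) : V k ∈ stiefel p d := by
  cases k with
  | zero => exact hV.1
  | succ k =>
    obtain ⟨μ, -, t, -, j, -, -, hproj⟩ := hV.2 k
    exact hproj.1

lemma IsSmoothInvariant.apply_eq_of_isProj (hf : IsSmoothInvariant f)
    {X Q : Matrix (Fin p) (Fin d) ℝ} (hX : Function.Injective X.mulVec) (hQ : IsProj X Q) :
    f Q = f X := by
  obtain ⟨M, hM, rfl⟩ := hQ.exists_eq_mul hX
  exact hf.mul_right X M hX hM

lemma IsSmoothInvariant.lagrangianGrad_multiplier (hf : IsSmoothInvariant f)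
    {V : Matrix (Fin p) (Fin d) ℝ} (hV : V ∈ stiefel p d) :
    lagrangianGrad f V (multiplier f V) = grad f V := by
  rw [lagrangianGrad, multiplier, hf.grad_transpose_mul (injective_mulVec_of_mem_stiefel hV),
    Matrix.mul_zero, sub_zero]

/-- If the sufficient decrease condition fails for step sizes tending to zero, then the limit of
the base points is a critical point. -/
lemma IsSmoothInvariant.grad_eq_zero_of_insufficient_decrease (hf : IsSmoothInvariant f) {ρ₁ : ℝ}
    (hρ₁ : ρ₁ < 1) {W : Matrix (Fin p) (Fin d) ℝ} (hW : Function.Injective W.mulVec)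
    {V : ℕ → Matrix (Fin p) (Fin d) ℝ} {μ s : ℕ → ℝ} (hμ : ∀ n, μ n ∈ Set.Icc (0 : ℝ) 1)
    (hVW : Tendsto V atTop (𝓝 W)) (hs : Tendsto s atTop (𝓝 0)) (hs0 : ∀ n, 0 < s n)
    (h : ∀ᶠ n in atTop, f (V n) - ρ₁ * s n * ‖grad f (V n)‖ ^ 2
      ≤ f (searchCurve f (V n) (μ n) (s n))) :
    grad f W = 0 := by
  have hG : Tendsto (fun n => grad f (V n)) atTop (𝓝 (grad f W)) :=
    (hf.continuousAt_grad hW).tendsto.comp hVW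
  have hμs : Tendsto (fun n => μ n * s n) atTop (𝓝 0) :=
    squeeze_zero (fun n => mul_nonneg (hμ n).1 (hs0 n).le)
      (fun n => mul_le_of_le_one_left (hs0 n).le (hμ n).2) hs
  have hskew : Tendsto (fun n => skewGrad f (V n)) atTop (𝓝 (skewGrad f W)) := by
    have hc : Continuous fun q : Matrix (Fin p) (Fin d) ℝ × Matrix (Fin p) (Fin d) ℝ =>
      q.1 * q.2ᵀ - q.2 * q.1ᵀ := by fun_prop
    have hcomp := (hc.tendsto (grad f W, W)).comp (hG.prodMk_nhds hVW)
    simp only [skewGrad]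
    exact hcomp
  have hD : Tendsto (fun n => scaling f (V n) (μ n) (s n) * grad f (V n)) atTop
      (𝓝 (grad f W)) := tendsto_one_add_smul_inv_mul hμs hskew hG
  have hstrict : HasStrictFDerivAt f (fderiv ℝ f W) W :=
    (hf.contDiffAt W hW).hasStrictFDerivAt one_ne_zero
  have hquot : Tendsto (fun n => (f (searchCurve f (V n) (μ n) (s n)) - f (V n)) / s n) atTop
      (𝓝 (-fderiv ℝ f W (grad f W))) :=
    tendsto_diffQuotient hstrict hVW hD hs (Eventually.of_forall fun n => (hs0 n).ne')
  rw [fderiv_grad] at hquot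
  -- The limit of the failed decrease inequality; `ρ₁ < 1` then forces the gradient to vanish.
  have hbound : -(ρ₁ * ‖grad f W‖ ^ 2) ≤ -‖grad f W‖ ^ 2 := by
    refine le_of_tendsto_of_tendsto ((hG.norm.pow 2).const_mul ρ₁).neg hquot ?_
    filter_upwards [h] with n hn
    rw [le_div_iff₀ (hs0 n)]
    linarith
  have hsq : ‖grad f W‖ ^ 2 = 0 := by nlinarith [sq_nonneg ‖grad f W‖]
  exact norm_eq_zero.1 (pow_eq_zero_iff two_ne_zero |>.1 hsq)

theorem IsSmoothInvariant.tendsto_grad (hf : IsSmoothInvariant f) {η ρ₁ δ τm τM : ℝ}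
    (hη : η ∈ Set.Ico (0 : ℝ) 1) (hρ₁ : ρ₁ ∈ Set.Ioo (0 : ℝ) 1) (hδ : δ ∈ Set.Ioo (0 : ℝ) 1)
    (hτm : 0 < τm) {V : ℕ → Matrix (Fin p) (Fin d) ℝ}
    (hV : IsSGPMSequence f η ρ₁ δ τm τM V) :
    Tendsto (fun k => grad f (V k)) atTop (𝓝 0) := by
  have hSt := hV.mem_stiefel
  choose μ hμ t ht j harm hfail hproj using hV.2
  have hτ0 : ∀ k, 0 < t k * δ ^ j k := fun k =>
    mul_pos (hτm.trans_le (ht k).1) (pow_pos hδ.1 _)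
  have hdec : ∀ k, f (V (k + 1)) ≤
      refValue f η V k - ρ₁ * (t k * δ ^ j k) * ‖grad f (V k)‖ ^ 2 := fun k => by
    rw [hf.apply_eq_of_isProj (hf.injective_searchCurve (hSt k) _ _) (hproj k)]
    exact armijo_iff.1 (harm k)
  have ha : ∀ k, 0 ≤ ρ₁ * (t k * δ ^ j k) * ‖grad f (V k)‖ ^ 2 := fun k =>
    mul_nonneg (mul_pos hρ₁.1 (hτ0 k)).le (sq_nonneg _)
  obtain ⟨b, hb⟩ : ∃ b, ∀ k, b ≤ f (V k) := by
    have hcont : ContinuousOn f (stiefel p d) := fun W hW =>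
      (hf.contDiffAt W (injective_mulVec_of_mem_stiefel hW)).continuousAt.continuousWithinAt
    obtain ⟨W, -, hW⟩ := (isCompact_stiefel p d).exists_isMinOn ⟨V 0, hSt 0⟩ hcont
    exact ⟨f W, fun k => hW (hSt k)⟩
  have hle := le_refValue hη.1 fun k => (hdec k).trans (sub_le_self _ (ha k))
  have hlim := tendsto_zero_of_sufficient_decrease hη hb ha hdec
  refine tendsto_of_subseq_tendsto fun ns hns => ?_
  have : FirstCountableTopology (Matrix (Fin p) (Fin d) ℝ) :=
    inferInstanceAs (FirstCountableTopology (Fin p → Fin d → ℝ))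
  obtain ⟨W, hW, ms, hms, hVW⟩ := (isCompact_stiefel p d).tendsto_subseq fun n => hSt (ns n)
  refine ⟨ms, ?_⟩
  have hWinj := injective_mulVec_of_mem_stiefel hW
  have hk : Tendsto (fun n => ns (ms n)) atTop atTop := hns.comp hms.tendsto_atTop
  have hG : Tendsto (fun n => grad f (V (ns (ms n)))) atTop (𝓝 (grad f W)) :=
    (hf.continuousAt_grad hWinj).tendsto.comp hVW
  suffices h : grad f W = 0 by rwa [h] at hG
  by_contra hne
  have hpos : 0 < ‖grad f W‖ ^ 2 := pow_pos (norm_pos_iff.2 hne) 2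
  have hG2 : Tendsto (fun n => ‖grad f (V (ns (ms n)))‖ ^ 2) atTop (𝓝 (‖grad f W‖ ^ 2)) :=
    hG.norm.pow 2
  -- Divide `ρ₁ τ_k ‖grad‖² → 0` by `ρ₁ ‖grad‖²`, whose limit is positive.
  have hτlim : Tendsto (fun n => t (ns (ms n)) * δ ^ j (ns (ms n))) atTop (𝓝 0) := by
    have h := (hlim.comp hk).div (hG2.const_mul ρ₁) (mul_pos hρ₁.1 hpos).ne'
    rw [zero_div] at h
    refine h.congr' ?_
    filter_upwards [hG2.eventually_ne hpos.ne'] with n hn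
    exact (div_eq_iff (mul_ne_zero hρ₁.1.ne' hn)).2 (mul_right_comm _ _ _ |>.trans (mul_comm _ _))
  have hs : Tendsto (fun n => t (ns (ms n)) * δ ^ j (ns (ms n)) / δ) atTop (𝓝 0) := by
    simpa using hτlim.div_const δ
  refine hne (hf.grad_eq_zero_of_insufficient_decrease hρ₁.2 hWinj (fun n => hμ (ns (ms n))) hVW hs
    (fun n => div_pos (hτ0 _) hδ.1) ?_)
  -- Once `τ_k < τm ≤ t_k`, backtracking has occurred, so `τ_k / δ` is the last rejected step.
  filter_upwards [hτlim.eventually_lt_const hτm] with n hn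
  have hj : j (ns (ms n)) ≠ 0 := by
    intro h0
    rw [h0, pow_zero, mul_one] at hn
    exact absurd (ht _).1 (not_le.2 hn)
  obtain ⟨i, hi⟩ := Nat.exists_eq_add_one_of_ne_zero hj
  have hsi : t (ns (ms n)) * δ ^ j (ns (ms n)) / δ = t (ns (ms n)) * δ ^ i := by
    rw [hi, pow_succ, ← mul_assoc, mul_div_cancel_right₀ _ hδ.1.ne']
  have hna := hfail (ns (ms n)) i (by omega)
  rw [armijo_iff, not_le, ← hsi] at hna
  -- The rejection is relative to `C_k`; as `f (V k) ≤ C_k`, the monotone test fails too.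
  exact (sub_le_sub_right (hle _) _).trans hna.le

end CIR

theorem theorem2 {p d : ℕ} (α : ℝ) (hα : 0 ≤ α)
    (f : Matrix (Fin p) (Fin d) ℝ → ℝ) (hf : CIR.IsLoss α f)
    (η ρ₁ δ τm τM : ℝ) (hη : η ∈ Set.Ico (0 : ℝ) 1) (hρ₁ : ρ₁ ∈ Set.Ioo (0 : ℝ) 1)
    (hδ : δ ∈ Set.Ioo (0 : ℝ) 1) (hτm : 0 < τm) (hτ : τm ≤ τM)
    (V : ℕ → Matrix (Fin p) (Fin d) ℝ) (hV : CIR.IsSGPMSequence f η ρ₁ δ τm τM V) :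
    (∀ Vstar, MapClusterPt Vstar atTop V → CIR.IsKKT f Vstar) ∧
      Tendsto (fun k => ‖CIR.lagrangianGrad f (V k) (CIR.multiplier f (V k))‖) atTop (𝓝 0) := by
  have hfi := hf.isSmoothInvariant
  have hlim := hfi.tendsto_grad hη hρ₁ hδ hτm hV
  refine ⟨fun W hW => ?_, ?_⟩
  · have hWSt : W ∈ CIR.stiefel p d :=
      (CIR.isCompact_stiefel p d).isClosed.mem_of_mapClusterPt hW
        (Eventually.of_forall hV.mem_stiefel)
    have hgrad : MapClusterPt (CIR.grad f W) atTop (fun k => CIR.grad f (V k)) :=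
      hW.continuousAt_comp
        (hfi.continuousAt_grad (CIR.injective_mulVec_of_mem_stiefel hWSt))
    have h0 : CIR.grad f W = 0 := by
      have hne : ClusterPt (CIR.grad f W) (𝓝 0) := ClusterPt.mono hgrad hlim
      exact eq_of_nhds_neBot hne
    -- The full gradient vanishes, so `Λ = 0` serves.
    exact ⟨⟨0, Matrix.isSymm_zero, by simp [CIR.lagrangianGrad, h0]⟩, hWSt⟩
  · simp only [hfi.lagrangianGrad_multiplier (hV.mem_stiefel _)]
    simpa using hlim.norm
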